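/- Let $d\in\mathbb N$ and $\mathbb I_d=\{1,\dots,d\}$. For a Hermitian $A\in M_d(\mathbb C)$ let $\lambda(A)=(\lambda_1(A)\ge\dots\ge\lambda_d(A))$ be its eigenvalues, counted with multiplicity, in decreasing order. For $x\in\mathbb R^d$ put $\operatorname{tr}x=\sum_i x_i$ and let $x^\downarrow$ be its decreasing rearrangement; write $x\prec_w y$ if $\sum_{i=1}^k x_i^\downarrow\le\sum_{i=1}^k y_i^\downarrow$ for every $k\in\mathbb I_d$. $\|\cdot\|$ is the spectral norm of matrices, and $v\otimes v$ is the operator $z\mapsto\langle z,v\rangle v$. Let $S\in M_d(\mathbb C)$ be positive definite, $0<\delta<1$ and $s\in[(1-\delta)^d,(1+\delta)^d]$. Let $$\mathcal O_{(s,\delta)}(S)=\{V^*SV:\ V\in M_d(\mathbb C)\text{ invertible},\ \|V^*V-I\|\le\delta,\ \det(V^*V)\ge s\}.$$ Define $$\lambda=(\log\lambda_i(S))_{i\in\mathbb I_d},\qquad t=\log\Big(\frac{s\,\det S}{(1-\delta)^d}\Big),\qquad \varepsilon=\log\Big(\frac{1+\delta}{1-\delta}\Big),$$ $$\Lambda=\Lambda_{(t,\varepsilon)}(\lambda,0)=\{\lambda+\eta:\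 \eta\in\mathbb R^d,\ 0\le\eta_i\le\varepsilon\ (i\in\mathbb I_d),\ \operatorname{tr}\eta\ge t-\operatorname{tr}\lambda\}.$$ Then $\lambda$ is decreasing, $t\ge\operatorname{tr}\lambda$ and $\varepsilon>0$, and there is a unique $\rho\in\Lambda$ such that $\operatorname{tr}\rho=t$, $\rho\prec_w\gamma$ for every $\gamma\in\Lambda$, and the entries of $\rho-\lambda$ are in increasing order. Put $\mu=(1-\delta)\exp(\rho)=((1-\delta)e^{\rho_i})_{i\in\mathbb I_d}$; it is a decreasing vector of positive numbers. Moreover: 1. There exists $\tilde S_0\in\mathcal O_{(s,\delta)}(S)$ such that $\lambda(\tilde S_0)=\mu$. 2. For every $\tilde S\in\mathcal O_{(s,\delta)}(S)$ and every $k\in\mathbb I_d$, $$\prod_{i=1}^k\mu_i\le\prod_{i=1}^k\lambda_i(\tilde S).$$ 3. Let $\tilde S=V^*SV$ with $V\in M_d(\mathbb C)$ invertible, $\|V^*V-I\|\le\delta$ and $\det(V^*V)\ge s$. Equality holds in item 2 for every $k\in\mathbb I_d$ (that is, $\mu=\lambda(\tilde S)$) if and only if $\det(V^*V)=s$ and there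 exists an orthonormal basis $\{v_i\}_{i\in\mathbb I_d}$ of $\mathbb C^d$ such that $$S=\sum_{i\in\mathbb I_d}\lambda_i(S)\,v_i\otimes v_i\qquad\text{and}\qquad VV^*=\sum_{i\in\mathbb I_d}\frac{\mu_i}{\lambda_i(S)}\,v_i\otimes v_i.$$ -/

import Mathlib

open scoped Matrix ComplexOrder

noncomputable section

namespace FramePert

/-- The vector `λ(A)` of the eigenvalues of a Hermitian matrix `A`, counted with multiplicity and
arranged in decreasing order. -/
def eigDown {d : ℕ} {A : Matrix (Fin d) (Fin d) ℂ} (hA : A.IsHermitian) : Fin d → ℝ :=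
  fun i => hA.eigenvalues₀ (Fin.cast (Fintype.card_fin d).symm i)

/-- The decreasing rearrangement `x↓` of a real vector. -/
def downArr {d : ℕ} (x : Fin d → ℝ) : Fin d → ℝ :=
  fun i => x (Tuple.sort x (Fin.rev i))

/-- Submajorization `x ≺_w y`: all partial sums of `x↓` are at most those of `y↓`. -/
def Submaj {d : ℕ} (x y : Fin d → ℝ) : Prop :=
  ∀ k : Fin d, ∑ i ∈ Finset.Iic k, downArr x i ≤ ∑ i ∈ Finset.Iic k, downArr y i

/-- The set `Λ_{(t,ε)}(lam, m)` of the vectors `lam + η` with `0 ≤ η i ≤ ε`,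
`tr η ≥ t - tr lam` and at most `d - m` nonzero entries in `η`. -/
def LambdaSet {d : ℕ} (t ε : ℝ) (lam : Fin d → ℝ) (m : ℤ) : Set (Fin d → ℝ) :=
  {γ | ∃ η : Fin d → ℝ, γ = lam + η ∧ (∀ i, 0 ≤ η i ∧ η i ≤ ε) ∧
    t - ∑ i, lam i ≤ ∑ i, η i ∧ ((Function.support η).ncard : ℤ) ≤ (d : ℤ) - m}

/-- `ρ` is the optimal vector `ρ_{(t,ε)}(lam, 0)`: an element of `Λ_{(t,ε)}(lam, 0)` of trace `t`
that is submajorized by every element of that set, and for which `ρ - lam` is arranged in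
increasing order. -/
structure IsOptimalVec {d : ℕ} (t ε : ℝ) (lam ρ : Fin d → ℝ) : Prop where
  mem : ρ ∈ LambdaSet t ε lam 0
  trace_eq : ∑ i, ρ i = t
  submaj : ∀ γ ∈ LambdaSet t ε lam 0, Submaj ρ γ
  mono : Monotone (ρ - lam)

open scoped Matrix.Norms.L2Operator in
/-- `V` is invertible, `‖V*V - I‖ ≤ δ` in the spectral norm, and `det (V*V) ≥ s`
(in the order of `ℂ`, where `s ≤ z` says that `z` is real and at least `s`). -/
def Admissible {d : ℕ} (s δ : ℝ) (V : Matrix (Fin d) (Fin d) ℂ) : Prop :=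
  IsUnit V ∧ ‖Vᴴ * V - 1‖ ≤ δ ∧ (s : ℂ) ≤ (Vᴴ * V).det

/-- The set `O_{(s,δ)}(S)` of the matrices `V*SV` with `V` admissible. -/
def OSet {d : ℕ} (s δ : ℝ) (S : Matrix (Fin d) (Fin d) ℂ) : Set (Matrix (Fin d) (Fin d) ℂ) :=
  {T | ∃ V : Matrix (Fin d) (Fin d) ℂ, Admissible s δ V ∧ T = Vᴴ * S * V}

theorem OSet.isHermitian {d : ℕ} {s δ : ℝ} {S T : Matrix (Fin d) (Fin d) ℂ}
    (hS : S.IsHermitian) (hT : T ∈ OSet s δ S) : T.IsHermitian := by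
  obtain ⟨V, -, rfl⟩ := hT
  exact Matrix.isHermitian_conjTranspose_mul_mul V hS

/-- The matrix of the rank one operator `x ⊗ y : z ↦ ⟨z, y⟩ x` (linear in `z`). -/
def rankOne {d : ℕ} (x y : EuclideanSpace ℂ (Fin d)) : Matrix (Fin d) (Fin d) ℂ :=
  Matrix.vecMulVec x.ofLp (star y.ofLp)

end FramePert

end

/-!
The lower bound on the spectrum of `VᴴSV` reduces to a problem about vectors. An admissible `V`
satisfies `(1 - δ) ≤ VVᴴ ≤ 1 + δ`, since `VVᴴ` and `VᴴV` have the same eigenvalues. Write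
`S = K Kᴴ` with `KᴴK = diagonal λ`. The matrix `M = Kᴴ(VVᴴ)K` has the spectrum of `VᴴSV` and lies
between `(1 - δ) diagonal λ` and `(1 + δ) diagonal λ`. By Weyl's monotonicity principle
(`eigDown_le_eigDown`) the vector `log (eigDown (VᴴSV) / (1 - δ))` exceeds `log λ` entrywise by at
least `0` and at most `ε`; its trace is controlled by the determinant, so it belongs to `Λ`
(`Admissible.log_eigDown_mem`), and the bound is the submajorization `ρ ≺_w γ`.

The optimal vector is explicit: `waterFill c ε lam` raises the entries of `lam` below a level `c`
up to `c`, but by no more than `ε`, where `c` is chosen, by the intermediate value theorem, to give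
the trace `t`. Its entries above `c` are the least possible in `Λ` and those below `c` the greatest
possible. This yields its minimality for
submajorization (`waterFill_submaj`, through sums of the form `∑ (xᵢ - τ)₊`) and for the Euclidean
norm, whence uniqueness (`IsOptimalVec.eq_waterFill`).

The same dichotomy settles the case of equality (`eq_diagonal_of_eigDown_eq`). If `M` has
spectrum `μ`, its trace and the trace of its square are known, and
`tr (M - diagonal μ)² = 2 ∑ (μᵢ - C)(μᵢ - Mᵢᵢ)` with `C = (1 - δ) exp c`. Where `μᵢ > C` the bound
`Mᵢᵢ ≥ (1 - δ) λᵢ = μᵢ` holds, and where `μᵢ < C` the bound `Mᵢᵢ ≤ (1 + δ) λᵢ = μᵢ`; so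
`M = diagonal μ`, that is, `VVᴴ` is diagonal with entries `μᵢ / λᵢ` in an eigenbasis of `S`.
Conversely the square root of that matrix is admissible and attains `μ`.
-/

namespace FramePert

/-! ### Decreasing rearrangements and submajorization -/

variable {d : ℕ}

lemma downArr_antitone (x : Fin d → ℝ) : Antitone (downArr x) := fun _ _ hij =>
  Tuple.monotone_sort x (Fin.rev_le_rev.mpr hij)

lemma sum_comp_downArr (x : Fin d → ℝ) (f : ℝ → ℝ) :
    ∑ i, f (downArr x i) = ∑ i, f (x i) :=
  Equiv.sum_comp (Fin.revPerm.trans (Tuple.sort x)) fun i => f (x i)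

lemma downArr_eq_self {x : Fin d → ℝ} (hx : Antitone x) : downArr x = x :=
  Tuple.unique_antitone (f := x) (σ := Fin.revPerm.trans (Tuple.sort x)) (τ := Equiv.refl _)
    (downArr_antitone x) hx

/-- Submajorization follows from the comparison of all sums `∑ (xᵢ - τ)₊`; for the `k`-th partial
sum, the threshold `τ` is the `k`-th largest entry of `y`. -/
lemma submaj_of_sum_max_le {x y : Fin d → ℝ}
    (h : ∀ τ : ℝ, ∑ i, max (x i - τ) 0 ≤ ∑ i, max (y i - τ) 0) : Submaj x y := by
  intro k
  set τ := downArr y k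
  have h1 : ∑ i ∈ Finset.Iic k, (downArr x i - τ) ≤ ∑ i, max (x i - τ) 0 := by
    rw [← sum_comp_downArr x fun z => max (z - τ) 0]
    calc ∑ i ∈ Finset.Iic k, (downArr x i - τ)
        ≤ ∑ i ∈ Finset.Iic k, max (downArr x i - τ) 0 :=
          Finset.sum_le_sum fun i _ => le_max_left _ _
      _ ≤ _ := Finset.sum_le_sum_of_subset_of_nonneg (Finset.subset_univ _)
          fun i _ _ => le_max_right _ _
  have h2 : ∑ i, max (y i - τ) 0 = ∑ i ∈ Finset.Iic k, (downArr y i - τ) := by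
    rw [← sum_comp_downArr y fun z => max (z - τ) 0]
    symm
    rw [← Finset.sum_subset (Finset.subset_univ (Finset.Iic k))]
    · exact Finset.sum_congr rfl fun i hi => (max_eq_left (sub_nonneg.mpr
        (downArr_antitone y (Finset.mem_Iic.mp hi)))).symm
    · intro i _ hi
      exact max_eq_right (sub_nonpos.mpr
        (downArr_antitone y (not_le.mp fun h => hi (Finset.mem_Iic.mpr h)).le))
  have h3 := (h1.trans (h τ)).trans_eq h2
  rw [Finset.sum_sub_distrib, Finset.sum_sub_distrib] at h3
  linarith

lemma eq_of_sum_Iic_eq {f g : Fin d → ℝ}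
    (h : ∀ k, ∑ i ∈ Finset.Iic k, f i = ∑ i ∈ Finset.Iic k, g i) : f = g := by
  funext k
  induction k using WellFoundedLT.induction with
  | ind k ih =>
    have hk := h k
    rw [← Finset.Iio_insert, Finset.sum_insert (by simp), Finset.sum_insert (by simp),
      Finset.sum_congr rfl fun i hi => ih i (Finset.mem_Iio.mp hi)] at hk
    linarith

lemma eq_of_prod_Iic_eq {f g : Fin d → ℝ} (hf : ∀ i, 0 < f i) (hg : ∀ i, 0 < g i)
    (h : ∀ k, ∏ i ∈ Finset.Iic k, f i = ∏ i ∈ Finset.Iic k, g i) : f = g := by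
  have : (fun i => Real.log (f i)) = fun i => Real.log (g i) := eq_of_sum_Iic_eq fun k => by
    rw [← Real.log_prod fun i _ => (hf i).ne', ← Real.log_prod fun i _ => (hg i).ne', h k]
  funext i
  exact Real.log_injOn_pos (hf i) (hg i) (congrFun this i)

lemma sum_sq_eq_of_submaj {x y : Fin d → ℝ} (hxy : Submaj x y) (hyx : Submaj y x) :
    ∑ i, x i ^ 2 = ∑ i, y i ^ 2 := by
  rw [← sum_comp_downArr x (· ^ 2), ← sum_comp_downArr y (· ^ 2),
    eq_of_sum_Iic_eq fun k => le_antisymm (hxy k) (hyx k)]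

/-! ### The optimal vector -/

/-- The vector obtained from `lam` by raising the entries below the level `c` up to `c`, but by no
more than `ε`. -/
def waterFill (c ε : ℝ) (lam : Fin d → ℝ) : Fin d → ℝ :=
  fun i => min (max (lam i) c) (lam i + ε)

variable {c ε t : ℝ} {lam γ : Fin d → ℝ}

lemma le_waterFill (hε : 0 ≤ ε) (i : Fin d) : lam i ≤ waterFill c ε lam i :=
  le_min (le_max_left _ _) (le_add_of_nonneg_right hε)

lemma waterFill_le (i : Fin d) : waterFill c ε lam i ≤ lam i + ε := min_le_right _ _

lemma waterFill_eq_of_gt (i : Fin d) (hε : 0 ≤ ε) (h : c < waterFill c ε lam i) :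
    waterFill c ε lam i = lam i := by
  have h1 : c < max (lam i) c := h.trans_le (min_le_left _ _)
  have h2 : c < lam i := by simpa using h1
  rw [waterFill, max_eq_left h2.le, min_eq_left (by linarith)]

lemma waterFill_eq_of_lt (i : Fin d) (h : waterFill c ε lam i < c) :
    waterFill c ε lam i = lam i + ε := by
  unfold waterFill at *
  rcases min_lt_iff.mp h with h1 | h1
  · exact absurd h1 (not_lt.mpr (le_max_right _ _))
  · exact min_eq_right (h1.le.trans (le_max_right _ _))

lemma waterFill_antitone (hl : Antitone lam) : Antitone (waterFill c ε lam) := fun _ _ hij =>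
  min_le_min (max_le_max (hl hij) le_rfl) (by linarith [hl hij])

lemma waterFill_sub_monotone (hl : Antitone lam) :
    Monotone (waterFill c ε lam - lam) := by
  have key : ∀ i, (waterFill c ε lam - lam) i = min (max 0 (c - lam i)) ε := fun i => by
    simp only [Pi.sub_apply, waterFill, ← min_sub_sub_right, ← max_sub_sub_right, sub_self,
      add_sub_cancel_left]
  intro i j hij
  rw [key, key]
  exact min_le_min (max_le_max le_rfl (by linarith [hl hij])) le_rfl

lemma exists_sum_waterFill_eq (hε : 0 ≤ ε) (h0 : ∑ i, lam i ≤ t) (h1 : t ≤ ∑ i, (lam i + ε)) :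
    ∃ c, ∑ i, waterFill c ε lam i = t := by
  have hB : ∀ i, |lam i| ≤ ∑ j, |lam j| := fun i =>
    Finset.single_le_sum (f := fun j => |lam j|) (fun j _ => abs_nonneg _) (Finset.mem_univ i)
  set B := ∑ j, |lam j|
  have hB0 : 0 ≤ B := Finset.sum_nonneg fun j _ => abs_nonneg _
  have hc : Continuous fun c => ∑ i, waterFill c ε lam i := by
    unfold waterFill
    fun_prop
  suffices ht : t ∈ Set.Icc (∑ i, waterFill (-B) ε lam i) (∑ i, waterFill (B + ε) ε lam i) by
    obtain ⟨c, -, hc⟩ := intermediate_value_Icc (by linarith) hc.continuousOn ht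
    exact ⟨c, hc⟩
  constructor
  · refine le_of_eq_of_le (Finset.sum_congr rfl fun i _ => ?_) h0
    rw [waterFill, max_eq_left (abs_le.mp (hB i)).1, min_eq_left (by linarith)]
  · refine h1.trans_eq (Finset.sum_congr rfl fun i _ => ?_)
    have := (abs_le.mp (hB i)).2
    rw [waterFill, max_eq_right (by linarith), min_eq_right (by linarith)]

lemma mem_LambdaSet_iff : γ ∈ LambdaSet t ε lam 0 ↔
    (∀ i, lam i ≤ γ i ∧ γ i ≤ lam i + ε) ∧ t ≤ ∑ i, γ i := by
  constructor
  · rintro ⟨η, rfl, h1, h2, -⟩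
    refine ⟨fun i => ⟨?_, ?_⟩, ?_⟩
    · simpa using (h1 i).1
    · simpa using (h1 i).2
    · simp only [Pi.add_apply, Finset.sum_add_distrib]
      linarith
  · rintro ⟨h1, h2⟩
    refine ⟨γ - lam, by simp, fun i => ?_, ?_, ?_⟩
    · simp only [Pi.sub_apply, sub_nonneg, tsub_le_iff_right]
      exact ⟨(h1 i).1, by linarith [(h1 i).2]⟩
    · simp only [Pi.sub_apply, Finset.sum_sub_distrib]
      linarith
    · have := Set.ncard_le_card (Function.support (γ - lam))
      rw [Nat.card_eq_fintype_card, Fintype.card_fin] at this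
      simpa using this

/-- Entries of `waterFill` above the level are minimal in `Λ`, and entries below it are maximal.
So for thresholds above the level the sums `∑ (xᵢ - τ)₊` compare termwise, and below it so do
the sums `∑ (τ - xᵢ)₊`, which differ from the former by the traces. -/
lemma waterFill_submaj (hε : 0 ≤ ε) (hc : ∑ i, waterFill c ε lam i = t)
    (hγ : γ ∈ LambdaSet t ε lam 0) : Submaj (waterFill c ε lam) γ := by
  obtain ⟨h1, h2⟩ := mem_LambdaSet_iff.mp hγ
  refine submaj_of_sum_max_le fun τ => ?_
  rcases le_or_gt c τ with hτ | hτ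
  · refine Finset.sum_le_sum fun i _ => ?_
    rcases le_or_gt (waterFill c ε lam i) τ with h | h
    · rw [max_eq_right (by linarith)]
      exact le_max_right _ _
    · rw [waterFill_eq_of_gt i hε (hτ.trans_lt h)]
      exact max_le_max (by linarith [(h1 i).1]) le_rfl
  · have key : ∀ x : ℝ, max (x - τ) 0 = (x - τ) + max (τ - x) 0 := fun x => by
      rcases le_total x τ with h | h
      · rw [max_eq_right (by linarith), max_eq_left (by linarith)]; ring
      · rw [max_eq_left (by linarith), max_eq_right (by linarith)]; ring
    simp only [key, Finset.sum_add_distrib, Finset.sum_sub_distrib]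
    refine add_le_add (by linarith) (Finset.sum_le_sum fun i _ => ?_)
    rcases le_or_gt τ (waterFill c ε lam i) with h | h
    · rw [max_eq_right (by linarith)]
      exact le_max_right _ _
    · rw [waterFill_eq_of_lt i (h.trans hτ)]
      exact max_le_max (by linarith [(h1 i).2]) le_rfl

lemma isOptimalVec_waterFill (hε : 0 ≤ ε) (hl : Antitone lam)
    (hc : ∑ i, waterFill c ε lam i = t) : IsOptimalVec t ε lam (waterFill c ε lam) where
  mem := mem_LambdaSet_iff.mpr ⟨fun i => ⟨le_waterFill hε i, waterFill_le i⟩, hc.ge⟩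
  trace_eq := hc
  submaj _ hγ := waterFill_submaj hε hc hγ
  mono := waterFill_sub_monotone hl

/-- Uniqueness of the optimal vector: `waterFill` is the point of least Euclidean norm among the
vectors of trace `t` in `Λ`, and two optimal vectors have the same norm. -/
lemma IsOptimalVec.eq_waterFill {ρ : Fin d → ℝ} (h : IsOptimalVec t ε lam ρ) (hε : 0 ≤ ε)
    (hl : Antitone lam) (hc : ∑ i, waterFill c ε lam i = t) : ρ = waterFill c ε lam := by
  have hw := isOptimalVec_waterFill hε hl hc
  have hsq := sum_sq_eq_of_submaj (hw.submaj _ h.mem) (h.submaj _ hw.mem)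
  have htr := h.trace_eq
  obtain ⟨h1, -⟩ := mem_LambdaSet_iff.mp h.mem
  set w := waterFill c ε lam with hwdef
  -- the variational inequality `⟨w - c, ρ - w⟩ ≥ 0`
  have hpos : 0 ≤ ∑ i, (w i - c) * (ρ i - w i) := Finset.sum_nonneg fun i _ => by
    rcases lt_trichotomy (w i) c with hi | hi | hi
    · have := waterFill_eq_of_lt i hi
      exact mul_nonneg_of_nonpos_of_nonpos (by linarith)
        (by rw [hwdef, this]; linarith [(h1 i).2])
    · simp [hi]
    · have := waterFill_eq_of_gt i hε hi
      exact mul_nonneg (by linarith) (by rw [hwdef, this]; linarith [(h1 i).1])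
  have hid : ∑ i, (ρ i - w i) ^ 2 = ∑ i, ρ i ^ 2 - ∑ i, w i ^ 2
      - 2 * (∑ i, (w i - c) * (ρ i - w i)) - 2 * c * (∑ i, ρ i - ∑ i, w i) := by
    simp only [Finset.mul_sum, ← Finset.sum_sub_distrib]
    exact Finset.sum_congr rfl fun i _ => by ring
  have hz : ∑ i, (ρ i - w i) ^ 2 = 0 :=
    le_antisymm (by rw [hid, hsq, htr, hc]; linarith) (Finset.sum_nonneg fun i _ => sq_nonneg _)
  funext i
  have := (Finset.sum_eq_zero_iff_of_nonneg fun i _ => sq_nonneg (ρ i - w i)).mp hz i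
    (Finset.mem_univ i)
  exact sub_eq_zero.mp (pow_eq_zero_iff two_ne_zero |>.mp this)

/-! ### Ordered eigenvalues and unitary diagonalization -/

open Matrix

variable {A B : Matrix (Fin d) (Fin d) ℂ}

lemma eigDown_antitone (hA : A.IsHermitian) : Antitone (eigDown hA) := fun _ _ hij =>
  hA.eigenvalues₀_antitone hij

/-- The matrix whose columns are the vectors of an orthonormal basis. -/
noncomputable def colMatrix (v : OrthonormalBasis (Fin d) ℂ (EuclideanSpace ℂ (Fin d))) :
    Matrix (Fin d) (Fin d) ℂ :=
  Matrix.of fun i j => v j i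

lemma colMatrix_conjTranspose_mul_self
    (v : OrthonormalBasis (Fin d) ℂ (EuclideanSpace ℂ (Fin d))) :
    (colMatrix v)ᴴ * colMatrix v = 1 := by
  ext i j
  have := orthonormal_iff_ite.mp v.orthonormal i j
  rw [EuclideanSpace.inner_eq_star_dotProduct] at this
  rw [Matrix.mul_apply, Matrix.one_apply, ← this]
  simp [dotProduct, colMatrix, mul_comm]

lemma colMatrix_mul_conjTranspose_self
    (v : OrthonormalBasis (Fin d) ℂ (EuclideanSpace ℂ (Fin d))) :
    colMatrix v * (colMatrix v)ᴴ = 1 :=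
  mul_eq_one_comm.mp (colMatrix_conjTranspose_mul_self v)

lemma sum_smul_rankOne (v : OrthonormalBasis (Fin d) ℂ (EuclideanSpace ℂ (Fin d)))
    (a : Fin d → ℂ) :
    ∑ i, a i • rankOne (v i) (v i) = colMatrix v * diagonal a * (colMatrix v)ᴴ := by
  ext i j
  rw [Matrix.sum_apply, Matrix.mul_apply]
  refine Finset.sum_congr rfl fun k _ => ?_
  simp [rankOne, vecMulVec_apply, colMatrix, Matrix.mul_diagonal]
  ring

open Polynomial in
lemma charpoly_colMatrix_conj (v : OrthonormalBasis (Fin d) ℂ (EuclideanSpace ℂ (Fin d)))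
    (a : Fin d → ℂ) :
    (colMatrix v * diagonal a * (colMatrix v)ᴴ).charpoly = ∏ i, (X - C (a i)) := by
  rw [charpoly_mul_comm, ← mul_assoc, colMatrix_conjTranspose_mul_self, one_mul,
    charpoly_diagonal]

lemma exists_eq_colMatrix_conj (hA : A.IsHermitian) :
    ∃ v : OrthonormalBasis (Fin d) ℂ (EuclideanSpace ℂ (Fin d)),
      A = colMatrix v * diagonal (fun i => (eigDown hA i : ℂ)) * (colMatrix v)ᴴ := by
  -- `eigenvalues` and `eigenvectorBasis` carry an arbitrary enumeration, which `σ` makes decreasing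
  let σ : Fin d ≃ Fin d := (finCongr (Fintype.card_fin d).symm).trans
    (Fintype.equivOfCardEq (Fintype.card_fin _))
  have hσ : ∀ i, eigDown hA i = hA.eigenvalues (σ i) := fun i => by
    simp [σ, eigDown, IsHermitian.eigenvalues]
  refine ⟨hA.eigenvectorBasis.reindex σ.symm, ?_⟩
  set v := hA.eigenvectorBasis.reindex σ.symm with hv
  have key : A * colMatrix v = colMatrix v * diagonal (fun i => (eigDown hA i : ℂ)) := by
    ext i j
    have h := congrFun (hA.mulVec_eigenvectorBasis (σ j)) i
    rw [Matrix.mul_diagonal, mul_comm, hσ]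
    simpa [colMatrix, hv, Matrix.mul_apply, mulVec, dotProduct] using h
  rw [← key, mul_assoc, colMatrix_mul_conjTranspose_self, mul_one]

open Polynomial in
lemma charpoly_eq_prod_eigDown (hA : A.IsHermitian) :
    A.charpoly = ∏ i, (X - C (eigDown hA i : ℂ)) := by
  obtain ⟨v, hv⟩ := exists_eq_colMatrix_conj hA
  conv_lhs => rw [hv, charpoly_colMatrix_conj]

lemma eq_of_antitone_of_map_eq {f g : Fin d → ℝ} (hf : Antitone f) (hg : Antitone g)
    (h : (Finset.univ.val : Multiset (Fin d)).map f = Finset.univ.val.map g) : f = g := by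
  rw [Fin.univ_val_map, Fin.univ_val_map, Multiset.coe_eq_coe] at h
  exact List.ofFn_injective (h.eq_of_pairwise' (List.sortedGE_iff_pairwise.mp hf.sortedGE_ofFn)
    (List.sortedGE_iff_pairwise.mp hg.sortedGE_ofFn))

open Polynomial in
lemma eigDown_eq_of_charpoly (hA : A.IsHermitian) {a : Fin d → ℝ} (ha : Antitone a)
    (h : A.charpoly = ∏ i, (X - C (a i : ℂ))) : eigDown hA = a := by
  rw [charpoly_eq_prod_eigDown hA] at h
  refine eq_of_antitone_of_map_eq (eigDown_antitone hA) ha ?_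
  have hr : ∀ b : Fin d → ℝ, (∏ i, (X - C (b i : ℂ))).roots.map Complex.re
      = Finset.univ.val.map b := fun b => by
    rw [roots_prod _ _ (Finset.prod_ne_zero_iff.mpr fun i _ => X_sub_C_ne_zero _)]
    simp [Function.comp_def]
  rw [← hr, ← hr, h]

lemma eigDown_eq_of_charpoly_eq (hA : A.IsHermitian) (hB : B.IsHermitian)
    (h : A.charpoly = B.charpoly) : eigDown hA = eigDown hB :=
  eigDown_eq_of_charpoly hA (eigDown_antitone hB) (h.trans (charpoly_eq_prod_eigDown hB))

lemma eigDown_diagonal {a : Fin d → ℝ} (ha : Antitone a)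
    (h : (diagonal fun i => (a i : ℂ)).IsHermitian) : eigDown h = a :=
  eigDown_eq_of_charpoly h ha (charpoly_diagonal _)

lemma det_eq_prod_eigDown (hA : A.IsHermitian) : A.det = ((∏ i, eigDown hA i : ℝ) : ℂ) := by
  obtain ⟨v, hv⟩ := exists_eq_colMatrix_conj hA
  conv_lhs => rw [hv, det_mul_comm, ← mul_assoc, colMatrix_conjTranspose_mul_self, one_mul,
    det_diagonal]
  push_cast
  rfl

lemma trace_eq_sum_eigDown (hA : A.IsHermitian) : A.trace = ((∑ i, eigDown hA i : ℝ) : ℂ) := by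
  obtain ⟨v, hv⟩ := exists_eq_colMatrix_conj hA
  conv_lhs => rw [hv, trace_mul_comm, ← mul_assoc, colMatrix_conjTranspose_mul_self, one_mul,
    trace_diagonal]
  push_cast
  rfl

lemma trace_mul_self_eq_sum_eigDown (hA : A.IsHermitian) :
    (A * A).trace = ((∑ i, eigDown hA i ^ 2 : ℝ) : ℂ) := by
  obtain ⟨v, hv⟩ := exists_eq_colMatrix_conj hA
  have : A * A = colMatrix v * (diagonal (fun i => (eigDown hA i : ℂ)) *
      diagonal (fun i => (eigDown hA i : ℂ))) * (colMatrix v)ᴴ := by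
    conv_lhs => rw [hv]
    simp only [mul_assoc]
    rw [← mul_assoc (colMatrix v)ᴴ (colMatrix v), colMatrix_conjTranspose_mul_self, one_mul]
  rw [this, trace_mul_comm, ← mul_assoc, colMatrix_conjTranspose_mul_self, one_mul,
    diagonal_mul_diagonal, trace_diagonal]
  push_cast
  exact Finset.sum_congr rfl fun i _ => (sq _).symm

/-! ### Monotonicity of the ordered eigenvalues -/

lemma re_star_dotProduct_colMatrix_conj
    (v : OrthonormalBasis (Fin d) ℂ (EuclideanSpace ℂ (Fin d))) (a : Fin d → ℝ)
    (x : Fin d → ℂ) :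
    (star x ⬝ᵥ ((colMatrix v * diagonal (fun i => (a i : ℂ)) * (colMatrix v)ᴴ) *ᵥ x)).re
      = ∑ i, a i * ‖((colMatrix v)ᴴ *ᵥ x) i‖ ^ 2 := by
  have h : star x ⬝ᵥ ((colMatrix v * diagonal (fun i => (a i : ℂ)) * (colMatrix v)ᴴ) *ᵥ x)
      = star ((colMatrix v)ᴴ *ᵥ x) ⬝ᵥ
        (diagonal (fun i => (a i : ℂ)) *ᵥ ((colMatrix v)ᴴ *ᵥ x)) := by
    rw [star_mulVec, conjTranspose_conjTranspose, ← dotProduct_mulVec, mulVec_mulVec,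
      mulVec_mulVec]
  rw [h]
  simp only [dotProduct, mulVec_diagonal, Complex.re_sum]
  refine Finset.sum_congr rfl fun i _ => ?_
  rw [← Complex.normSq_eq_norm_sq, Complex.normSq_apply]
  simp
  ring

lemma sum_norm_sq_colMatrix_conjTranspose_mulVec
    (v : OrthonormalBasis (Fin d) ℂ (EuclideanSpace ℂ (Fin d))) (x : Fin d → ℂ) :
    ∑ i, ‖((colMatrix v)ᴴ *ᵥ x) i‖ ^ 2 = (star x ⬝ᵥ x).re := by
  have h := re_star_dotProduct_colMatrix_conj v (fun _ => 1) x
  simp only [Complex.ofReal_one, diagonal_one, mul_one, colMatrix_mul_conjTranspose_self,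
    one_mulVec, one_mul] at h
  exact h.symm

/-- Weyl's monotonicity principle. The vector on which the two quadratic forms are compared has no
component along the eigenvectors of `A` after the `i`-th and along those of `B` before the `i`-th;
it is a null vector of a matrix encoding these conditions, whose `i`-th row is zero. -/
lemma eigDown_le_eigDown (hA : A.IsHermitian) (hB : B.IsHermitian) (h : (B - A).PosSemidef)
    (i : Fin d) : eigDown hA i ≤ eigDown hB i := by
  obtain ⟨u, hu⟩ := exists_eq_colMatrix_conj hA
  obtain ⟨w, hw⟩ := exists_eq_colMatrix_conj hB
  let M : Matrix (Fin d) (Fin d) ℂ := Matrix.of fun j =>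
    if i < j then (colMatrix u)ᴴ j else if j < i then (colMatrix w)ᴴ j else 0
  have hM : M.det = 0 := det_eq_zero_of_row_eq_zero i fun j => by simp [M]
  obtain ⟨x, hx0, hx⟩ := exists_mulVec_eq_zero_iff.mpr hM
  have hxu : ∀ j, i < j → ((colMatrix u)ᴴ *ᵥ x) j = 0 := fun j hj => by
    have := congrFun hx j
    simpa [M, mulVec, hj] using this
  have hxw : ∀ j, j < i → ((colMatrix w)ᴴ *ᵥ x) j = 0 := fun j hj => by
    have := congrFun hx j
    simpa [M, mulVec, hj, hj.not_gt] using this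
  have hpos : 0 < (star x ⬝ᵥ x).re := by
    have := (dotProduct_star_self_pos_iff (v := x)).mpr hx0
    exact (Complex.pos_iff.mp this).1
  have h1 : eigDown hA i * (star x ⬝ᵥ x).re ≤ (star x ⬝ᵥ (A *ᵥ x)).re := by
    have e := re_star_dotProduct_colMatrix_conj u (eigDown hA) x
    rw [← hu] at e
    rw [e, ← sum_norm_sq_colMatrix_conjTranspose_mulVec u, Finset.mul_sum]
    refine Finset.sum_le_sum fun j _ => ?_
    rcases lt_or_ge i j with hj | hj
    · simp [hxu j hj]
    · exact mul_le_mul_of_nonneg_right (eigDown_antitone hA hj) (sq_nonneg _)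
  have h2 : (star x ⬝ᵥ (B *ᵥ x)).re ≤ eigDown hB i * (star x ⬝ᵥ x).re := by
    have e := re_star_dotProduct_colMatrix_conj w (eigDown hB) x
    rw [← hw] at e
    rw [e, ← sum_norm_sq_colMatrix_conjTranspose_mulVec w, Finset.mul_sum]
    refine Finset.sum_le_sum fun j _ => ?_
    rcases lt_or_ge j i with hj | hj
    · simp [hxw j hj]
    · exact mul_le_mul_of_nonneg_right (eigDown_antitone hB hj) (sq_nonneg _)
  have h3 : (star x ⬝ᵥ (A *ᵥ x)).re ≤ (star x ⬝ᵥ (B *ᵥ x)).re := by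
    have := h.re_dotProduct_nonneg x
    rw [sub_mulVec, dotProduct_sub] at this
    simpa using this
  exact le_of_mul_le_mul_right (h1.trans (h3.trans h2)) hpos

/-! ### Rigidity -/

/-- A Hermitian matrix with spectrum `m` is `diagonal m` as soon as, for some `c`, every `m i` above
`c` is at most the `i`-th diagonal entry and every `m i` below `c` is at least that entry:
this makes the Frobenius distance `tr (M - diagonal m)² = 2 ∑ (mᵢ - c)(mᵢ - Mᵢᵢ)` nonpositive. -/
lemma eq_diagonal_of_eigDown_eq {M : Matrix (Fin d) (Fin d) ℂ} (hM : M.IsHermitian)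
    {m : Fin d → ℝ} (hm : eigDown hM = m) (c : ℝ)
    (h : ∀ i, (m i - c) * (m i - (M i i).re) ≤ 0) : M = diagonal fun i => (m i : ℂ) := by
  have htr : ∑ i, (M i i).re = ∑ i, m i := by
    have := congrArg Complex.re (trace_eq_sum_eigDown hM)
    rw [hm, Complex.ofReal_re] at this
    simpa [Matrix.trace] using this
  have hN : (M - diagonal fun i => (m i : ℂ)).IsHermitian :=
    hM.sub (by simp [IsHermitian, diagonal_conjTranspose, Pi.star_def])
  set D : Matrix (Fin d) (Fin d) ℂ := diagonal fun i => (m i : ℂ) with hD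
  have hMD : (M * D).trace.re = ∑ i, (M i i).re * m i := by
    simp [hD, Matrix.trace, Matrix.mul_diagonal]
  have hDD : (D * D).trace.re = ∑ i, m i ^ 2 := by
    simp [hD, Matrix.trace, sq]
  have hMM : (M * M).trace.re = ∑ i, m i ^ 2 := by
    rw [trace_mul_self_eq_sum_eigDown hM, hm, Complex.ofReal_re]
  have hNN : ((M - D)ᴴ * (M - D)).trace.re = 2 * ∑ i, (m i - c) * (m i - (M i i).re) := by
    have e : ((M - D)ᴴ * (M - D)).trace
        = (M * M).trace - (M * D).trace - (M * D).trace + (D * D).trace := by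
      rw [hN.eq, sub_mul, mul_sub, mul_sub, trace_sub, trace_sub, trace_sub, trace_mul_comm D M]
      ring
    have e2 : ∑ i, (m i - c) * (m i - (M i i).re) = ∑ i, m i ^ 2 - ∑ i, (M i i).re * m i
        - c * (∑ i, m i - ∑ i, (M i i).re) := by
      simp only [Finset.mul_sum, ← Finset.sum_sub_distrib]
      exact Finset.sum_congr rfl fun i _ => by ring
    rw [e, Complex.add_re, Complex.sub_re, Complex.sub_re, hMM, hMD, hDD, e2, htr]
    ring
  have h0 := (posSemidef_conjTranspose_mul_self (M - D)).trace_nonneg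
  have h1 : ((M - D)ᴴ * (M - D)).trace = 0 := by
    obtain ⟨hre, him⟩ := Complex.nonneg_iff.mp h0
    refine Complex.ext (le_antisymm ?_ hre) him.symm
    rw [hNN]
    have := Finset.sum_nonpos fun i (_ : i ∈ Finset.univ) => h i
    simp only [Complex.zero_re]
    linarith
  exact sub_eq_zero.mp (trace_conjTranspose_mul_self_eq_zero_iff.mp h1)

/-! ### Admissible matrices -/

/-- A nonzero eigenvalue `b` of `VVᴴ` with eigenvector `w` is also one of `VᴴV`, with eigenvector
`Vᴴw`, so it is within `‖VᴴV - 1‖` of `1`. -/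
lemma abs_eigenvalue_sub_one_le {s δ : ℝ} {V : Matrix (Fin d) (Fin d) ℂ} (hV : Admissible s δ V)
    {w : Fin d → ℂ} (hw : w ≠ 0) {b : ℝ} (hb : (V * Vᴴ) *ᵥ w = b • w) : |b - 1| ≤ δ := by
  open scoped Matrix.Norms.L2Operator in
  obtain ⟨hu, hn, -⟩ := hV
  have hy0 : Vᴴ *ᵥ w ≠ 0 := fun h0 => by
    have h1 := congrArg ((Vᴴ)⁻¹ *ᵥ ·) h0
    have hdet : IsUnit (Vᴴ).det := (isUnit_iff_isUnit_det _).mp hu.star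
    simp only [mulVec_mulVec, nonsing_inv_mul _ hdet, one_mulVec, mulVec_zero] at h1
    exact hw h1
  have hy : (Vᴴ * V - 1) *ᵥ (Vᴴ *ᵥ w) = (b - 1) • (Vᴴ *ᵥ w) := by
    rw [sub_mulVec, one_mulVec, mulVec_mulVec, mul_assoc, ← mulVec_mulVec, hb, mulVec_smul,
      sub_smul, one_smul]
  have h2 : ‖WithLp.toLp 2 ((Vᴴ * V - 1) *ᵥ (Vᴴ *ᵥ w))‖
      ≤ ‖Vᴴ * V - 1‖ * ‖WithLp.toLp 2 (Vᴴ *ᵥ w)‖ :=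
    l2_opNorm_mulVec (Vᴴ * V - 1) (WithLp.toLp 2 (Vᴴ *ᵥ w))
  rw [hy, WithLp.toLp_smul, norm_smul, Real.norm_eq_abs] at h2
  have hpos : 0 < ‖WithLp.toLp 2 (Vᴴ *ᵥ w)‖ := norm_pos_iff.mpr fun h => hy0 (by simpa using h)
  exact (le_of_mul_le_mul_right h2 hpos).trans hn

lemma Admissible.posSemidef_mul_conjTranspose_sub {s δ : ℝ} {V : Matrix (Fin d) (Fin d) ℂ}
    (hV : Admissible s δ V) : (V * Vᴴ - ((1 - δ : ℝ) : ℂ) • 1).PosSemidef := by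
  have hH : (V * Vᴴ - ((1 - δ : ℝ) : ℂ) • 1).IsHermitian := by
    refine (isHermitian_mul_conjTranspose_self V).sub ?_
    rw [IsHermitian, conjTranspose_smul, conjTranspose_one]
    simp
  rw [hH.posSemidef_iff_eigenvalues_nonneg]
  intro i
  have h := hH.mulVec_eigenvectorBasis i
  rw [sub_mulVec, smul_mulVec, one_mulVec, sub_eq_iff_eq_add] at h
  have h2 := abs_eigenvalue_sub_one_le hV (w := ⇑(hH.eigenvectorBasis i))
    (b := hH.eigenvalues i + (1 - δ))
    ((WithLp.ofLp_eq_zero 2).ne.2 <| hH.eigenvectorBasis.orthonormal.ne_zero i)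
    (by rw [h, add_smul]; ext j; simp)
  have := (abs_le.mp h2).1
  simp only [Pi.zero_apply]
  linarith

lemma Admissible.posSemidef_sub_mul_conjTranspose {s δ : ℝ} {V : Matrix (Fin d) (Fin d) ℂ}
    (hV : Admissible s δ V) : (((1 + δ : ℝ) : ℂ) • 1 - V * Vᴴ).PosSemidef := by
  have hH : (((1 + δ : ℝ) : ℂ) • 1 - V * Vᴴ).IsHermitian := by
    refine IsHermitian.sub ?_ (isHermitian_mul_conjTranspose_self V)
    rw [IsHermitian, conjTranspose_smul, conjTranspose_one]
    simp
  rw [hH.posSemidef_iff_eigenvalues_nonneg]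
  intro i
  have h := hH.mulVec_eigenvectorBasis i
  rw [sub_mulVec, smul_mulVec, one_mulVec, sub_eq_iff_eq_add'] at h
  have h2 := abs_eigenvalue_sub_one_le hV (w := ⇑(hH.eigenvectorBasis i))
    (b := (1 + δ) - hH.eigenvalues i)
    ((WithLp.ofLp_eq_zero 2).ne.2 <| hH.eigenvectorBasis.orthonormal.ne_zero i)
    (by rw [sub_smul, eq_sub_iff_add_eq, ← h]; ext j; simp)
  have := (abs_le.mp h2).2
  simp only [Pi.zero_apply]
  linarith

/-- A positive matrix with eigenvectors `v` and eigenvalues `q i` in `[1 - δ, 1 + δ]` has an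
admissible square root. -/
lemma admissible_colMatrix_conj {s δ : ℝ} (hδ1 : δ < 1) (hδ : 0 < δ)
    (v : OrthonormalBasis (Fin d) ℂ (EuclideanSpace ℂ (Fin d))) {q : Fin d → ℝ}
    (hq : ∀ i, 1 - δ ≤ q i ∧ q i ≤ 1 + δ) (hs : s ≤ ∏ i, q i) :
    ∃ V, Admissible s δ V ∧
      V * Vᴴ = colMatrix v * diagonal (fun i => (q i : ℂ)) * (colMatrix v)ᴴ := by
  open scoped Matrix.Norms.L2Operator in
  have hq0 : ∀ i, 0 < q i := fun i => by linarith [(hq i).1]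
  set D : Matrix (Fin d) (Fin d) ℂ := diagonal fun i => ((√(q i) : ℝ) : ℂ) with hD
  have hDH : Dᴴ = D := by
    rw [hD, diagonal_conjTranspose]
    congr 1
    ext i
    simp
  have hDD : D * D = diagonal fun i => (q i : ℂ) := by
    rw [hD, diagonal_mul_diagonal]
    congr 1
    ext i
    rw [← Complex.ofReal_mul, Real.mul_self_sqrt (hq0 i).le]
  set V := colMatrix v * D * (colMatrix v)ᴴ with hV
  have hVH : Vᴴ = V := by
    simp only [hV, conjTranspose_mul, conjTranspose_conjTranspose, hDH, mul_assoc]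
  have hVV : V * V = colMatrix v * diagonal (fun i => (q i : ℂ)) * (colMatrix v)ᴴ := by
    rw [← hDD, hV]
    simp only [mul_assoc]
    rw [← mul_assoc (colMatrix v)ᴴ (colMatrix v), colMatrix_conjTranspose_mul_self, one_mul]
  have hdet : (V * V).det = ((∏ i, q i : ℝ) : ℂ) := by
    rw [hVV, det_mul_comm, ← mul_assoc, colMatrix_conjTranspose_mul_self, one_mul, det_diagonal]
    push_cast
    rfl
  refine ⟨V, ⟨?_, ?_, ?_⟩, by rw [hVH, hVV]⟩
  · rw [isUnit_iff_isUnit_det, isUnit_iff_ne_zero]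
    intro h0
    rw [det_mul, h0, mul_zero] at hdet
    exact (Finset.prod_pos fun i _ => hq0 i).ne' (by exact_mod_cast hdet.symm)
  · have hmem : colMatrix v ∈ unitary (Matrix (Fin d) (Fin d) ℂ) :=
      ⟨colMatrix_conjTranspose_mul_self v, colMatrix_mul_conjTranspose_self v⟩
    have e : Vᴴ * V - 1
        = colMatrix v * diagonal (fun i => (q i : ℂ) - 1) * star (colMatrix v) := by
      rw [hVH, hVV, ← diagonal_sub, diagonal_one, mul_sub, sub_mul, mul_one, star_eq_conjTranspose,
        colMatrix_mul_conjTranspose_self]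
    rw [e, CStarRing.norm_mul_mem_unitary _ (Unitary.star_mem hmem),
      CStarRing.norm_mem_unitary_mul _ hmem, l2_opNorm_diagonal]
    refine (pi_norm_le_iff_of_nonneg hδ.le).mpr fun i => ?_
    rw [← Complex.ofReal_one, ← Complex.ofReal_sub, Complex.norm_real, Real.norm_eq_abs, abs_le]
    constructor <;> linarith [(hq i).1, (hq i).2]
  · rw [hVH, hdet]
    exact_mod_cast hs

/-! ### Spectra of the congruences `VᴴSV` -/

lemma eigDown_pos {S : Matrix (Fin d) (Fin d) ℂ} (hS : S.PosDef) (i : Fin d) :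
    0 < eigDown hS.isHermitian i := by
  have := hS.eigenvalues_pos (Fintype.equivOfCardEq (Fintype.card_fin _)
    (Fin.cast (Fintype.card_fin d).symm i))
  simpa [IsHermitian.eigenvalues, eigDown] using this

/-- A square root factorization `S = K Kᴴ` with orthogonal columns. -/
lemma exists_orthogonal_factor {S : Matrix (Fin d) (Fin d) ℂ} (hS : S.PosDef) :
    ∃ (v : OrthonormalBasis (Fin d) ℂ (EuclideanSpace ℂ (Fin d))),
      S = colMatrix v * diagonal (fun i => (eigDown hS.isHermitian i : ℂ)) * (colMatrix v)ᴴ ∧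
      ∃ K : Matrix (Fin d) (Fin d) ℂ,
        K = colMatrix v * diagonal (fun i => ((√(eigDown hS.isHermitian i) : ℝ) : ℂ)) ∧
        S = K * Kᴴ ∧ Kᴴ * K = diagonal fun i => (eigDown hS.isHermitian i : ℂ) := by
  obtain ⟨v, hv⟩ := exists_eq_colMatrix_conj hS.isHermitian
  refine ⟨v, hv, _, rfl, ?_, ?_⟩
  all_goals
    have hDH : (diagonal fun i => ((√(eigDown hS.isHermitian i) : ℝ) : ℂ))ᴴ
        = diagonal fun i => ((√(eigDown hS.isHermitian i) : ℝ) : ℂ) := by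
      rw [diagonal_conjTranspose]
      congr 1
      ext i
      simp
    have hDD : (diagonal fun i => ((√(eigDown hS.isHermitian i) : ℝ) : ℂ)) *
        (diagonal fun i => ((√(eigDown hS.isHermitian i) : ℝ) : ℂ))
        = diagonal fun i => (eigDown hS.isHermitian i : ℂ) := by
      rw [diagonal_mul_diagonal]
      congr 1
      ext i
      rw [← Complex.ofReal_mul, Real.mul_self_sqrt (eigDown_pos hS i).le]
    rw [conjTranspose_mul, hDH]
  · conv_lhs => rw [hv, ← hDD]
    simp only [mul_assoc]
  · rw [← hDD, mul_assoc, ← mul_assoc (colMatrix v)ᴴ, colMatrix_conjTranspose_mul_self, one_mul]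

variable {s δ : ℝ} {S V : Matrix (Fin d) (Fin d) ℂ}

lemma eigDown_conj_eq (hS : S.IsHermitian) {K : Matrix (Fin d) (Fin d) ℂ} (hK : S = K * Kᴴ)
    (V : Matrix (Fin d) (Fin d) ℂ) :
    eigDown (isHermitian_conjTranspose_mul_mul K (isHermitian_mul_conjTranspose_self V))
      = eigDown (isHermitian_conjTranspose_mul_mul V hS) := by
  refine eigDown_eq_of_charpoly_eq _ _ ?_
  have e1 : Vᴴ * S * V = (Vᴴ * K) * (Kᴴ * V) := by rw [hK]; simp only [mul_assoc]
  have e2 : Kᴴ * (V * Vᴴ) * K = (Kᴴ * V) * (Vᴴ * K) := by simp only [mul_assoc]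
  rw [e1, e2, charpoly_mul_comm]

lemma Admissible.posSemidef_conj_sub (hV : Admissible s δ V) {K : Matrix (Fin d) (Fin d) ℂ}
    {L : Fin d → ℝ} (hK : Kᴴ * K = diagonal fun i => (L i : ℂ)) :
    (Kᴴ * (V * Vᴴ) * K - diagonal fun i => (((1 - δ) * L i : ℝ) : ℂ)).PosSemidef := by
  have h := hV.posSemidef_mul_conjTranspose_sub.conjTranspose_mul_mul_same K
  convert h using 1
  rw [mul_sub, sub_mul, mul_smul_comm, mul_one, smul_mul_assoc, hK, ← diagonal_smul]
  simp [Pi.smul_def]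

lemma Admissible.posSemidef_sub_conj (hV : Admissible s δ V) {K : Matrix (Fin d) (Fin d) ℂ}
    {L : Fin d → ℝ} (hK : Kᴴ * K = diagonal fun i => (L i : ℂ)) :
    ((diagonal fun i => (((1 + δ) * L i : ℝ) : ℂ)) - Kᴴ * (V * Vᴴ) * K).PosSemidef := by
  have h := hV.posSemidef_sub_mul_conjTranspose.conjTranspose_mul_mul_same K
  convert h using 1
  rw [mul_sub, sub_mul, mul_smul_comm, mul_one, smul_mul_assoc, hK, ← diagonal_smul]
  simp [Pi.smul_def]

lemma isHermitian_diagonal_ofReal (a : Fin d → ℝ) :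
    (diagonal fun i => (a i : ℂ)).IsHermitian := by
  simp [IsHermitian, diagonal_conjTranspose, Pi.star_def]

/-- Multiplicative Ostrowski bounds for the spectrum of `VᴴSV`. -/
lemma Admissible.eigDown_bounds (hV : Admissible s δ V) (hS : S.PosDef) (hδ : 0 < δ) (hδ1 : δ < 1)
    (i : Fin d) :
    (1 - δ) * eigDown hS.isHermitian i
        ≤ eigDown (isHermitian_conjTranspose_mul_mul V hS.isHermitian) i ∧
      eigDown (isHermitian_conjTranspose_mul_mul V hS.isHermitian) i
        ≤ (1 + δ) * eigDown hS.isHermitian i := by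
  obtain ⟨v, -, K, -, hSK, hKK⟩ := exists_orthogonal_factor hS
  rw [← eigDown_conj_eq hS.isHermitian hSK V]
  have hanti : ∀ r : ℝ, 0 ≤ r → Antitone fun i => r * eigDown hS.isHermitian i :=
    fun r hr a b hab => mul_le_mul_of_nonneg_left (eigDown_antitone _ hab) hr
  constructor
  · have h := eigDown_le_eigDown (isHermitian_diagonal_ofReal _)
      (isHermitian_conjTranspose_mul_mul K (isHermitian_mul_conjTranspose_self V))
      (hV.posSemidef_conj_sub hKK) i
    rwa [eigDown_diagonal (hanti _ (by linarith))] at h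
  · have h := eigDown_le_eigDown
      (isHermitian_conjTranspose_mul_mul K (isHermitian_mul_conjTranspose_self V))
      (isHermitian_diagonal_ofReal _) (hV.posSemidef_sub_conj hKK) i
    rwa [eigDown_diagonal (hanti _ (by linarith))] at h

lemma Admissible.exists_det_eq (hV : Admissible s δ V) :
    ∃ r : ℝ, s ≤ r ∧ (Vᴴ * V).det = (r : ℂ) := by
  obtain ⟨h1, h2⟩ := Complex.le_def.mp hV.2.2
  exact ⟨_, by simpa using h1, Complex.ext rfl (by simpa using h2.symm)⟩

lemma prod_eigDown_conj (hS : S.IsHermitian) {r : ℝ} (hr : (Vᴴ * V).det = (r : ℂ)) :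
    ∏ i, eigDown (isHermitian_conjTranspose_mul_mul V hS) i = r * ∏ i, eigDown hS i := by
  have h := det_eq_prod_eigDown (isHermitian_conjTranspose_mul_mul V hS)
  rw [det_mul, det_mul, mul_right_comm, ← det_mul, hr, det_eq_prod_eigDown hS,
    ← Complex.ofReal_mul] at h
  exact_mod_cast h.symm

/-- After rescaling by `1 - δ`, the logarithms of the eigenvalues of `VᴴSV` form a vector of
`Λ`. -/
lemma Admissible.log_eigDown_mem (hV : Admissible s δ V) (hS : S.PosDef) (hδ : 0 < δ)
    (hδ1 : δ < 1) (hs : 0 < s) :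
    (fun i => Real.log (eigDown (isHermitian_conjTranspose_mul_mul V hS.isHermitian) i / (1 - δ)))
      ∈ LambdaSet (Real.log (s * (∏ i, eigDown hS.isHermitian i) / (1 - δ) ^ d))
        (Real.log ((1 + δ) / (1 - δ))) (fun i => Real.log (eigDown hS.isHermitian i)) 0 := by
  have hb := hV.eigDown_bounds hS hδ hδ1
  have hL := eigDown_pos hS
  have h0 : 0 < 1 - δ := by linarith
  have hT : ∀ i, 0 < eigDown (isHermitian_conjTranspose_mul_mul V hS.isHermitian) i := fun i =>
    (mul_pos h0 (hL i)).trans_le (hb i).1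
  obtain ⟨r, hsr, hr⟩ := hV.exists_det_eq
  have hP := Finset.prod_pos fun i (_ : i ∈ Finset.univ) => hL i
  refine mem_LambdaSet_iff.mpr ⟨fun i => ⟨?_, ?_⟩, ?_⟩
  · refine Real.log_le_log (hL i) ((le_div_iff₀ h0).mpr ?_)
    linarith [(hb i).1]
  · rw [← Real.log_mul (hL i).ne' (by positivity)]
    refine Real.log_le_log (div_pos (hT i) h0) ?_
    rw [mul_div_assoc', div_le_div_iff_of_pos_right h0]
    linarith [(hb i).2]
  · rw [← Real.log_prod fun i _ => (div_pos (hT i) h0).ne', Finset.prod_div_distrib,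
      prod_eigDown_conj hS.isHermitian hr, Finset.prod_const, Finset.card_univ, Fintype.card_fin]
    refine Real.log_le_log (by positivity) ?_
    gcongr

lemma eq_colMatrix_conj_of_conj_eq_diagonal
    (v : OrthonormalBasis (Fin d) ℂ (EuclideanSpace ℂ (Fin d))) {L m : Fin d → ℝ}
    (hL : ∀ i, 0 < L i) {B K : Matrix (Fin d) (Fin d) ℂ}
    (hK : K = colMatrix v * diagonal fun i => ((√(L i) : ℝ) : ℂ))
    (h : Kᴴ * B * K = diagonal fun i => (m i : ℂ)) :
    B = colMatrix v * diagonal (fun i => ((m i / L i : ℝ) : ℂ)) * (colMatrix v)ᴴ := by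
  have key : (colMatrix v)ᴴ * B * colMatrix v = diagonal fun i => ((m i / L i : ℝ) : ℂ) := by
    set E := (colMatrix v)ᴴ * B * colMatrix v with hE
    have e : Kᴴ * B * K = (diagonal fun i => ((√(L i) : ℝ) : ℂ)) * E *
        diagonal fun i => ((√(L i) : ℝ) : ℂ) := by
      rw [hK, conjTranspose_mul, (isHermitian_diagonal_ofReal fun i => √(L i)).eq, hE]
      simp only [mul_assoc]
    rw [e] at h
    have hne : ∀ i, ((√(L i) : ℝ) : ℂ) ≠ 0 := fun i =>
      Complex.ofReal_ne_zero.mpr (Real.sqrt_pos.mpr (hL i)).ne'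
    ext i j
    have hij := congrFun (congrFun h i) j
    rw [mul_diagonal, diagonal_mul] at hij
    rcases eq_or_ne i j with rfl | hne'
    · rw [diagonal_apply_eq] at hij ⊢
      have hsq : ((√(L i) : ℝ) : ℂ) * ((√(L i) : ℝ) : ℂ) = (L i : ℂ) := by
        rw [← Complex.ofReal_mul, Real.mul_self_sqrt (hL i).le]
      rw [Complex.ofReal_div, eq_div_iff (Complex.ofReal_ne_zero.mpr (hL i).ne'), ← hij, ← hsq]
      ring
    · rw [diagonal_apply_ne _ hne'] at hij ⊢
      simpa [hne i, hne j] using hij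
  rw [← key]
  simp only [mul_assoc]
  rw [colMatrix_mul_conjTranspose_self, mul_one, ← mul_assoc, colMatrix_mul_conjTranspose_self,
    one_mul]

/-- If `VVᴴ` and `S` are diagonal in the same orthonormal basis, then the spectrum of `VᴴSV` is read
off from the products of their eigenvalues. -/
lemma eigDown_conj_of_simultaneous (hS : S.IsHermitian)
    (v : OrthonormalBasis (Fin d) ℂ (EuclideanSpace ℂ (Fin d))) {L m : Fin d → ℝ}
    (hL : ∀ i, L i ≠ 0) (hm : Antitone m)
    (hSv : S = colMatrix v * diagonal (fun i => (L i : ℂ)) * (colMatrix v)ᴴ)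
    (hVv : V * Vᴴ = colMatrix v * diagonal (fun i => ((m i / L i : ℝ) : ℂ)) * (colMatrix v)ᴴ) :
    eigDown (isHermitian_conjTranspose_mul_mul V hS) = m := by
  refine eigDown_eq_of_charpoly _ hm ?_
  rw [mul_assoc, charpoly_mul_comm, mul_assoc, hVv]
  conv_lhs => rw [hSv]
  have : colMatrix v * diagonal (fun i => (L i : ℂ)) * (colMatrix v)ᴴ *
      (colMatrix v * diagonal (fun i => ((m i / L i : ℝ) : ℂ)) * (colMatrix v)ᴴ)
      = colMatrix v * diagonal (fun i => (m i : ℂ)) * (colMatrix v)ᴴ := by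
    simp only [mul_assoc]
    rw [← mul_assoc (colMatrix v)ᴴ (colMatrix v), colMatrix_conjTranspose_mul_self, one_mul,
      ← mul_assoc (diagonal _) (diagonal _), diagonal_mul_diagonal]
    congr 3
    ext i
    rw [← Complex.ofReal_mul, mul_div_cancel₀ _ (hL i)]
  rw [this, charpoly_colMatrix_conj]

/-- The case of equality: in the eigenbasis of `S`, the matrix `KᴴVVᴴK` lies between
`(1 - δ) diagonal λ` and `(1 + δ) diagonal λ`, one of which is tight at every entry of `μ` that
differs from `(1 - δ) exp c`. -/
lemma Admissible.exists_basis_of_eigDown_eq (hV : Admissible s δ V) (hS : S.PosDef) (hδ : 0 < δ)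
    (hδ1 : δ < 1) {c : ℝ}
    (h : ∀ i, eigDown (isHermitian_conjTranspose_mul_mul V hS.isHermitian) i
      = (1 - δ) * Real.exp (waterFill c (Real.log ((1 + δ) / (1 - δ)))
          (fun i => Real.log (eigDown hS.isHermitian i)) i)) :
    ∃ v : OrthonormalBasis (Fin d) ℂ (EuclideanSpace ℂ (Fin d)),
      S = colMatrix v * diagonal (fun i => (eigDown hS.isHermitian i : ℂ)) * (colMatrix v)ᴴ ∧
      V * Vᴴ = colMatrix v * diagonal (fun i =>
        ((eigDown (isHermitian_conjTranspose_mul_mul V hS.isHermitian) i /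
          eigDown hS.isHermitian i : ℝ) : ℂ)) * (colMatrix v)ᴴ := by
  obtain ⟨v, hSv, K, hK, hSK, hKK⟩ := exists_orthogonal_factor hS
  have hL := eigDown_pos hS
  have h0 : 0 < 1 - δ := by linarith
  have hε : 0 ≤ Real.log ((1 + δ) / (1 - δ)) :=
    Real.log_nonneg ((one_le_div h0).mpr (by linarith))
  refine ⟨v, hSv, eq_colMatrix_conj_of_conj_eq_diagonal v hL hK ?_⟩
  refine eq_diagonal_of_eigDown_eq _ (eigDown_conj_eq hS.isHermitian hSK V)
    ((1 - δ) * Real.exp c) fun i => ?_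
  have hlo : (1 - δ) * eigDown hS.isHermitian i ≤ ((Kᴴ * (V * Vᴴ) * K) i i).re := by
    have := (Complex.nonneg_iff.mp ((hV.posSemidef_conj_sub hKK).diag_nonneg (i := i))).1
    rw [Matrix.sub_apply, diagonal_apply_eq, Complex.sub_re, Complex.ofReal_re] at this
    linarith
  have hup : ((Kᴴ * (V * Vᴴ) * K) i i).re ≤ (1 + δ) * eigDown hS.isHermitian i := by
    have := (Complex.nonneg_iff.mp ((hV.posSemidef_sub_conj hKK).diag_nonneg (i := i))).1
    rw [Matrix.sub_apply, diagonal_apply_eq, Complex.sub_re, Complex.ofReal_re] at this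
    linarith
  rw [h i, ← mul_sub]
  set w := waterFill c (Real.log ((1 + δ) / (1 - δ)))
    (fun i => Real.log (eigDown hS.isHermitian i)) with hw
  rcases lt_trichotomy (w i) c with hi | hi | hi
  · have e : (1 - δ) * Real.exp (w i) = (1 + δ) * eigDown hS.isHermitian i := by
      rw [hw, waterFill_eq_of_lt i hi, Real.exp_add, Real.exp_log (hL i),
        Real.exp_log (by positivity)]
      field_simp
    refine mul_nonpos_of_nonpos_of_nonneg (mul_nonpos_of_nonneg_of_nonpos h0.le ?_) (by linarith)
    linarith [Real.exp_lt_exp.mpr hi]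
  · simp [hi]
  · have e : (1 - δ) * Real.exp (w i) = (1 - δ) * eigDown hS.isHermitian i := by
      rw [hw, waterFill_eq_of_gt i hε hi, Real.exp_log (hL i)]
    refine mul_nonpos_of_nonneg_of_nonpos (mul_nonneg h0.le ?_) (by linarith)
    linarith [Real.exp_lt_exp.mpr hi]

end FramePert

/-! ### The spectral minimizer -/

open FramePert Matrix in
theorem theorem5p2 (d : ℕ) (S : Matrix (Fin d) (Fin d) ℂ) (hS : S.PosDef)
    (δ : ℝ) (hδ : 0 < δ) (hδ1 : δ < 1)
    (s : ℝ) (hs : s ∈ Set.Icc ((1 - δ) ^ d) ((1 + δ) ^ d))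
    (lam : Fin d → ℝ) (hlam : ∀ i, lam i = Real.log (FramePert.eigDown hS.isHermitian i))
    (t : ℝ) (ht : t = Real.log (s * S.det.re / (1 - δ) ^ d))
    (ε : ℝ) (hε : ε = Real.log ((1 + δ) / (1 - δ))) :
    -- the data are as required, and the optimal vector exists and is unique
    Antitone lam ∧ ∑ i, lam i ≤ t ∧ 0 < ε ∧
    (∃! ρ : Fin d → ℝ, FramePert.IsOptimalVec t ε lam ρ) ∧
    ∀ ρ μ : Fin d → ℝ, FramePert.IsOptimalVec t ε lam ρ →
      (∀ i, μ i = (1 - δ) * Real.exp (ρ i)) →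
      -- `μ` is a decreasing vector of positive numbers
      (Antitone μ ∧ ∀ i, 0 < μ i) ∧
      -- `μ` is attained as a spectrum
      (∃ (T : Matrix (Fin d) (Fin d) ℂ) (hT : T ∈ FramePert.OSet s δ S),
        FramePert.eigDown (FramePert.OSet.isHermitian hS.isHermitian hT) = μ) ∧
      -- the partial products of `μ` are lower bounds
      (∀ (T : Matrix (Fin d) (Fin d) ℂ) (hT : T ∈ FramePert.OSet s δ S) (k : Fin d),
        ∏ i ∈ Finset.Iic k, μ i ≤ ∏ i ∈ Finset.Iic k,
          FramePert.eigDown (FramePert.OSet.isHermitian hS.isHermitian hT) i) ∧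
      -- the case of equality
      (∀ V : Matrix (Fin d) (Fin d) ℂ, FramePert.Admissible s δ V →
        ((∀ k : Fin d, ∏ i ∈ Finset.Iic k, μ i = ∏ i ∈ Finset.Iic k,
            FramePert.eigDown
              (Matrix.isHermitian_conjTranspose_mul_mul V hS.isHermitian) i) ↔
          μ = FramePert.eigDown
            (Matrix.isHermitian_conjTranspose_mul_mul V hS.isHermitian)) ∧
        ((∀ k : Fin d, ∏ i ∈ Finset.Iic k, μ i = ∏ i ∈ Finset.Iic k,
            FramePert.eigDown
              (Matrix.isHermitian_conjTranspose_mul_mul V hS.isHermitian) i) ↔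
          (Vᴴ * V).det = (s : ℂ) ∧
          ∃ v : OrthonormalBasis (Fin d) ℂ (EuclideanSpace ℂ (Fin d)),
            S = ∑ i, (FramePert.eigDown hS.isHermitian i : ℂ) •
              FramePert.rankOne (v i) (v i) ∧
            V * Vᴴ = ∑ i, ((μ i / FramePert.eigDown hS.isHermitian i : ℝ) : ℂ) •
              FramePert.rankOne (v i) (v i))) := by
  have hl : Antitone lam := fun i j hij => by
    rw [hlam, hlam]
    exact Real.log_le_log (eigDown_pos hS j) (eigDown_antitone _ hij)
  have hL := eigDown_pos hS
  have h0 : 0 < 1 - δ := by linarith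
  have hspos : 0 < s := (pow_pos h0 d).trans_le hs.1
  have hP := Finset.prod_pos fun i (_ : i ∈ Finset.univ) => hL i
  have hdetS : S.det.re = ∏ i, eigDown hS.isHermitian i := by
    rw [det_eq_prod_eigDown hS.isHermitian, Complex.ofReal_re]
  have hlam' : lam = fun i => Real.log (eigDown hS.isHermitian i) := funext hlam
  have hsum : ∑ i, lam i = Real.log (∏ i, eigDown hS.isHermitian i) := by
    rw [hlam', ← Real.log_prod fun i _ => (hL i).ne']
  rw [hdetS] at ht
  have htl : t - ∑ i, lam i = Real.log (s / (1 - δ) ^ d) := by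
    rw [ht, hsum, ← Real.log_div (by positivity) hP.ne']
    congr 1
    field_simp
  have hε0 : 0 < ε := hε ▸ Real.log_pos ((one_lt_div h0).mpr (by linarith))
  have hlow : ∑ i, lam i ≤ t := by
    have : 0 ≤ Real.log (s / (1 - δ) ^ d) :=
      Real.log_nonneg ((one_le_div (pow_pos h0 d)).mpr hs.1)
    linarith
  have hupp : t ≤ ∑ i, (lam i + ε) := by
    have : Real.log (s / (1 - δ) ^ d) ≤ d * ε := by
      rw [hε, ← Real.log_pow, div_pow]
      refine Real.log_le_log (by positivity) ?_
      gcongr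
      exact hs.2
    rw [Finset.sum_add_distrib, Finset.sum_const, Finset.card_univ, Fintype.card_fin,
      nsmul_eq_mul]
    linarith
  obtain ⟨c, hc⟩ := exists_sum_waterFill_eq hε0.le hlow hupp
  refine ⟨hl, hlow, hε0, ⟨waterFill c ε lam, isOptimalVec_waterFill hε0.le hl hc,
    fun ρ hρ => hρ.eq_waterFill hε0.le hl hc⟩, fun ρ μ hρ hμ => ?_⟩
  have hρw := hρ.eq_waterFill hε0.le hl hc
  have hρanti : Antitone ρ := hρw ▸ waterFill_antitone hl
  have hμanti : Antitone μ := fun i j hij => by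
    rw [hμ, hμ]
    exact mul_le_mul_of_nonneg_left (Real.exp_le_exp.mpr (hρanti hij)) h0.le
  have hμpos : ∀ i, 0 < μ i := fun i => hμ i ▸ mul_pos h0 (Real.exp_pos _)
  have hμprod : ∏ i, μ i = s * ∏ i, eigDown hS.isHermitian i := by
    simp only [hμ, Finset.prod_mul_distrib, Finset.prod_const, Finset.card_univ,
      Fintype.card_fin]
    rw [← Real.exp_sum, hρ.trace_eq, ht, Real.exp_log (by positivity)]
    field_simp
  have hTpos : ∀ V, Admissible s δ V → ∀ i,
      0 < eigDown (isHermitian_conjTranspose_mul_mul V hS.isHermitian) i := fun V hV i =>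
    (mul_pos h0 (hL i)).trans_le (hV.eigDown_bounds hS hδ hδ1 i).1
  refine ⟨⟨hμanti, hμpos⟩, ?_, ?_, fun V hV => ?_⟩
  · -- the minimizer is `VᴴSV` with `V` the square root of `μ / λ` in an eigenbasis of `S`
    obtain ⟨v, hv⟩ := exists_eq_colMatrix_conj hS.isHermitian
    obtain ⟨hmem, -⟩ := mem_LambdaSet_iff.mp hρ.mem
    have hq : ∀ i, 1 - δ ≤ μ i / eigDown hS.isHermitian i ∧
        μ i / eigDown hS.isHermitian i ≤ 1 + δ := fun i => by
      have hlo := Real.exp_le_exp.mpr (hmem i).1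
      have hup := Real.exp_le_exp.mpr (hmem i).2
      rw [hlam, Real.exp_log (hL i)] at hlo
      rw [hlam, hε, Real.exp_add, Real.exp_log (hL i), Real.exp_log (by positivity)] at hup
      rw [le_div_iff₀ (hL i), div_le_iff₀ (hL i), hμ]
      refine ⟨mul_le_mul_of_nonneg_left hlo h0.le,
        (mul_le_mul_of_nonneg_left hup h0.le).trans_eq ?_⟩
      field_simp
    obtain ⟨V, hV, hVV⟩ := admissible_colMatrix_conj (s := s) hδ1 hδ v hq
      (by rw [Finset.prod_div_distrib, hμprod, mul_div_cancel_right₀ _ hP.ne'])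
    exact ⟨_, ⟨V, hV, rfl⟩, eigDown_conj_of_simultaneous hS.isHermitian v
      (fun i => (hL i).ne') hμanti hv hVV⟩
  · rintro T ⟨V, hV, rfl⟩ k
    have hγ := hV.log_eigDown_mem hS hδ hδ1 hspos
    rw [← ht, ← hε, ← hlam'] at hγ
    have hγanti : Antitone fun i => Real.log
        (eigDown (isHermitian_conjTranspose_mul_mul V hS.isHermitian) i / (1 - δ)) :=
      fun i j hij => Real.log_le_log (div_pos (hTpos V hV j) h0)
        (div_le_div_of_nonneg_right (eigDown_antitone _ hij) h0.le)
    have hk := hρ.submaj _ hγ k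
    rw [downArr_eq_self hρanti, downArr_eq_self hγanti] at hk
    have he := Real.exp_le_exp.mpr hk
    rw [Real.exp_sum, Real.exp_sum] at he
    simp only [hμ, Finset.prod_mul_distrib]
    refine (mul_le_mul_of_nonneg_left he
      (Finset.prod_nonneg fun _ _ => h0.le)).trans_eq ?_
    rw [← Finset.prod_mul_distrib]
    refine Finset.prod_congr rfl fun i _ => ?_
    rw [Real.exp_log (div_pos (hTpos V hV i) h0), mul_div_cancel₀ _ h0.ne']
  · have hiff : (∀ k : Fin d, ∏ i ∈ Finset.Iic k, μ i = ∏ i ∈ Finset.Iic k,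
        eigDown (isHermitian_conjTranspose_mul_mul V hS.isHermitian) i) ↔
        μ = eigDown (isHermitian_conjTranspose_mul_mul V hS.isHermitian) :=
      ⟨fun h => eq_of_prod_Iic_eq hμpos (hTpos V hV) h, fun h k => by rw [h]⟩
    refine ⟨hiff, hiff.trans ⟨fun h => ⟨?_, ?_⟩, ?_⟩⟩
    · obtain ⟨r, -, hr⟩ := hV.exists_det_eq
      have hrs := prod_eigDown_conj hS.isHermitian hr
      rw [← h, hμprod] at hrs
      rw [hr, mul_right_cancel₀ hP.ne' hrs]
    · obtain ⟨v, h1, h2⟩ := hV.exists_basis_of_eigDown_eq hS hδ hδ1 (c := c) fun i => by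
        rw [← h, ← hε, ← hlam', ← hρw, hμ]
      exact ⟨v, by rw [sum_smul_rankOne]; exact h1, by rw [sum_smul_rankOne, h]; exact h2⟩
    · rintro ⟨-, v, h1, h2⟩
      rw [sum_smul_rankOne] at h1 h2
      exact (eigDown_conj_of_simultaneous hS.isHermitian v (fun i => (hL i).ne') hμanti h1
        h2).symm
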